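/- Let $g\in L^2(\mathbb R)$ (complex valued) be such that for almost every $t\in[0,1]$ at most two of the numbers $g(t-n)$, $n\in\mathbb Z$, are non-zero. For $k\in\mathbb Z$ put $$G_k(t)=\sum_{n\in\mathbb Z} g(t-n)\,\overline{g(t-n-k)} ,$$ a series which converges absolutely for almost every $t$. The following are equivalent. (1) $(g,1,1)$ is a WH-frame (Weyl–Heisenberg frame), i.e. the functions $t\mapsto e^{2\pi i m t}g(t-n)$, $m,n\in\mathbb Z$, form a frame for $L^2(\mathbb R)$: there are constants $0<A\le B<\infty$ such that $$A\|f\|^2\le\sum_{m,n\in\mathbb Z}\Bigl|\int_{\mathbb R} f(t)\,\overline{e^{2\pi i m t}g(t-n)}\,dt\Bigr|^2\le B\|f\|^2\qquad\text{for all } f\in L^2(\mathbb R).$$ (2) The Casazza–Christensen condition holds: $$\operatorname*{ess\,sup}_{t\in[0,1]}\ \sum_{k\in\mathbb Z}|G_k(t)|<\infty\qquad\text{and}\qquad \operatorname*{ess\,inf}_{t\in[0,1]}\Bigl[G_0(t)-\sum_{k\ne0}|G_k(t)|\Bigr]>0 .$$ (3) There are constants $0<A\le B<\infty$ such that $A\le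 G_0(t)\le B$ for almost every $t\in\mathbb R$, and there is a constant $A'>0$ such that, for almost every $t\in\mathbb R$ with $g(t)\neq0$, $$\bigl|\,|g(t)|-|g(t-n)|\,\bigr|\ge A'\qquad\text{for all } n\in\mathbb Z,\ n\ne0,\ \text{with } g(t-n)\ne0 .$$ -/

import Mathlib

open MeasureTheory
open scoped ComplexConjugate

/-- A family `f` of vectors of a Hilbert space is a frame: for some `0 < A` and `B` one has
`A ‖x‖² ≤ ∑ |⟨x, f i⟩|² ≤ B ‖x‖²` for all `x`. -/
def IsFrame {ι H : Type*} [NormedAddCommGroup H] [InnerProductSpace ℂ H] (f : ι → H) : Prop :=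
  ∃ A B : ℝ, 0 < A ∧ ∀ x : H,
    Summable (fun i => ‖inner ℂ x (f i)‖ ^ 2) ∧
    A * ‖x‖ ^ 2 ≤ ∑' i, ‖inner ℂ x (f i)‖ ^ 2 ∧
    ∑' i, ‖inner ℂ x (f i)‖ ^ 2 ≤ B * ‖x‖ ^ 2

/-- The function `E_{mb} T_{na} g`, i.e. `t ↦ e^{2πimbt} g(t - na)`. -/
noncomputable def whFun (g : ℝ → ℂ) (a b : ℝ) (m n : ℤ) (t : ℝ) : ℂ :=
  Complex.exp (((2 * Real.pi * (m * b * t) : ℝ) : ℂ) * Complex.I) * g (t - n * a)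

theorem memLp_whFun {g : ℝ → ℂ} (hg : MemLp g 2 volume) (a b : ℝ) (m n : ℤ) :
    MemLp (whFun g a b m n) 2 volume := by
  have h1 : MemLp (fun t : ℝ => g (t - n * a)) 2 volume :=
    hg.comp_measurePreserving (measurePreserving_sub_right volume (n * a))
  have hc : Continuous (fun t : ℝ =>
      Complex.exp (((2 * Real.pi * (m * b * t) : ℝ) : ℂ) * Complex.I)) := by
    fun_prop
  refine MemLp.of_le h1 (hc.aestronglyMeasurable.mul h1.aestronglyMeasurable) ?_
  refine Filter.Eventually.of_forall fun t => ?_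
  simp only [whFun, norm_mul, Complex.norm_exp_ofReal_mul_I, one_mul, le_refl]

/-- The Weyl–Heisenberg system `(E_{mb} T_{na} g)_{m, n ∈ ℤ}` in `L²(ℝ)`. -/
noncomputable def whSystem (g : ℝ → ℂ) (hg : MemLp g 2 volume) (a b : ℝ) :
    ℤ × ℤ → Lp ℂ 2 (volume : Measure ℝ) :=
  fun p => (memLp_whFun hg a b p.1 p.2).toLp (whFun g a b p.1 p.2)

/-- `(g, a, b)` is a WH-frame for `L²(ℝ)`. -/
def IsWHFrame (g : ℝ → ℂ) (hg : MemLp g 2 volume) (a b : ℝ) : Prop :=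
  IsFrame (whSystem g hg a b)

/-- `G_k(t) = ∑_{n ∈ ℤ} g(t - na) conj g(t - na - k/b)`. For `g ∈ L²(ℝ)` and `0 < a` the series
converges absolutely for almost every `t`. -/
noncomputable def whG (g : ℝ → ℂ) (a b : ℝ) (k : ℤ) (t : ℝ) : ℂ :=
  ∑' n : ℤ, g (t - n * a) * conj (g (t - n * a - k / b))

/-- The Casazza–Christensen condition: over `t ∈ [0, a]`, the essential infimum of
`G_0(t) - ∑_{k ≠ 0} |G_k(t)|` is positive and the essential supremum of `∑_k |G_k(t)|` is
finite. (`G_0(t)` is a nonnegative real number, read here as the real part of `whG g a b 0 t`.) -/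
def CCCondition (g : ℝ → ℂ) (a b : ℝ) : Prop :=
  (∃ B : ℝ, ∀ᵐ t ∂(volume.restrict (Set.Icc 0 a)),
    Summable (fun k : ℤ => ‖whG g a b k t‖) ∧ ∑' k : ℤ, ‖whG g a b k t‖ ≤ B) ∧
  (∃ A : ℝ, 0 < A ∧ ∀ᵐ t ∂(volume.restrict (Set.Icc 0 a)),
    A ≤ (whG g a b 0 t).re - ∑' k : {k : ℤ // k ≠ 0}, ‖whG g a b k t‖)

/-! For fixed `n`, the inner products of `f` with the system are, up to the sign of the index, the
Fourier coefficients of the 1-periodic function `latticeCorr f g n`. Parseval over `m` turns the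
frame sum into an integral over (0,1] of ∑ₙ |`latticeCorr f g n t`|². The frame inequality thus
decouples into convolution inequalities on ℓ²(ℤ), one for each coset t + ℤ. If a coset carries only
x = g(t-p) and y = g(t-q), the convolution is a combination of two distinct shifts. The modulus of
its symbol is |x + e^{iθ}y|, with minimum ||x|-|y|| and maximum |x|+|y|. So the frame property
amounts to uniform bounds (|x|-|y|)² ≥ A and |x|²+|y|² ≤ B, which is `HasSeparatedPairs`; all three
conditions are compared with it. On such a coset G₀ = |x|²+|y|², and the only other possibly nonzero
correlations are G_{±(q-p)}, of modulus |x||y|. Hence G₀ - ∑_{k≠0}|G_k| = (|x|-|y|)² and ∑|G_k| =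
(|x|+|y|)². If x or y vanishes, then (|x|-|y|)² = G₀, which explains the two clauses of (3). -/

open Set
open scoped ENNReal

/-! ### Periodization and Parseval -/

/-- The lattice correlation `t ↦ ∑ⱼ conj f(t + j) g(t + j - n)`. -/
noncomputable def latticeCorr (f g : ℝ → ℂ) (n : ℤ) (t : ℝ) : ℂ :=
  ∑' j : ℤ, conj (f (t + j)) * g (t + j - n)

theorem enorm_sq_eq_ofReal {E : Type*} [SeminormedAddCommGroup E] (z : E) :
    ‖z‖ₑ ^ 2 = ENNReal.ofReal (‖z‖ ^ 2) := by
  rw [← ofReal_norm, ENNReal.ofReal_pow (norm_nonneg z)]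

theorem quasiMeasurePreserving_add_const (a : ℝ) :
    Measure.QuasiMeasurePreserving (fun t : ℝ => t + a) volume volume :=
  (measurePreserving_add_right volume a).quasiMeasurePreserving

theorem lintegral_Ioc_tsum_add_int {h : ℝ → ℝ≥0∞} (hh : AEMeasurable h volume) :
    ∫⁻ t in Ioc (0 : ℝ) 1, ∑' j : ℤ, h (t + j) = ∫⁻ t, h t := by
  rw [lintegral_tsum (f := fun (j : ℤ) (t : ℝ) => h (t + j)) fun j : ℤ =>
    (hh.comp_quasiMeasurePreserving (quasiMeasurePreserving_add_const (j : ℝ))).restrict]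
  rw [← setLIntegral_univ (μ := volume) h, ← iUnion_Ioc_intCast ℝ,
    lintegral_iUnion (fun _ => measurableSet_Ioc) (pairwise_disjoint_Ioc_intCast ℝ)]
  refine tsum_congr fun j => ?_
  have := (measurePreserving_add_right volume (j : ℝ)).setLIntegral_comp_preimage_emb
    (MeasurableEquiv.addRight (j : ℝ)).measurableEmbedding h (Ioc (j : ℝ) (j + 1))
  rw [← this]
  congr 2
  ext x
  simp

theorem integral_Ioc_tsum_add_int {h : ℝ → ℂ} (hh : Integrable h volume) :
    ∫ t in (0 : ℝ)..1, ∑' j : ℤ, h (t + j) = ∫ t, h t := by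
  rw [← hh.hasSum_intervalIntegral_comp_add_int.tsum_eq]
  simp_rw [intervalIntegral.integral_of_le zero_le_one]
  refine (integral_tsum_of_summable_integral_norm (fun j : ℤ =>
    (hh.comp_add_right (j : ℝ)).restrict) ?_).symm
  have := hh.norm.hasSum_intervalIntegral_comp_add_int.summable
  simpa only [intervalIntegral.integral_of_le zero_le_one] using this

theorem inner_whSystem_eq_fourierCoeffOn {f g : ℝ → ℂ} (hf : MemLp f 2 volume)
    (hg : MemLp g 2 volume) (m n : ℤ) :
    inner ℂ (hf.toLp f) (whSystem g hg 1 1 (m, n)) =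
      fourierCoeffOn (zero_lt_one (α := ℝ)) (latticeCorr f g n) (-m) := by
  have hw := memLp_whFun hg 1 1 m n
  have hfw : Integrable (fun t => conj (f t) * whFun g 1 1 m n t) := hf.star.integrable_mul hw
  have h1 : inner ℂ (hf.toLp f) (whSystem g hg 1 1 (m, n)) =
      ∫ t, conj (f t) * whFun g 1 1 m n t := by
    rw [L2.inner_def]
    refine integral_congr_ae ?_
    filter_upwards [hf.coeFn_toLp, hw.coeFn_toLp] with t h2 h3
    rw [h2]
    simp only [whSystem]
    rw [h3, RCLike.inner_apply, mul_comm]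
  rw [h1, ← integral_Ioc_tsum_add_int hfw, fourierCoeffOn_eq_integral]
  simp only [sub_zero, one_div, inv_one, one_smul, neg_neg]
  refine intervalIntegral.integral_congr fun t _ => ?_
  simp only [latticeCorr, smul_eq_mul, ← tsum_mul_left]
  refine tsum_congr fun j => ?_
  -- The exponents differ by 2πi·mj, so the modulation is constant along the coset.
  have h2 : Complex.exp (((2 * Real.pi * (m * (1 : ℝ) * (t + j)) : ℝ) : ℂ) * Complex.I) =
      fourier m (t : AddCircle (1 - 0 : ℝ)) := by
    rw [fourier_coe_apply, Complex.exp_eq_exp_iff_exists_int]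
    refine ⟨m * j, ?_⟩
    push_cast
    ring
  simp only [whFun]
  rw [h2]
  simp only [mul_one]
  ring

theorem tsum_enorm_fourierCoeffOn {c : ℝ → ℂ}
    (hc : MemLp c 2 (volume.restrict (Ioc (0 : ℝ) 1))) :
    ∑' m : ℤ, ‖fourierCoeffOn (zero_lt_one (α := ℝ)) c m‖ₑ ^ 2 =
      ∫⁻ t in Ioc (0 : ℝ) 1, ‖c t‖ₑ ^ 2 := by
  have h := hasSum_sq_fourierCoeffOn (zero_lt_one (α := ℝ)) hc
  simp_rw [enorm_sq_eq_ofReal]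
  rw [← ENNReal.ofReal_tsum_of_nonneg (fun _ => by positivity) h.summable, h.tsum_eq,
    intervalIntegral.integral_of_le zero_le_one,
    ← ofReal_integral_eq_lintegral_ofReal ((memLp_two_iff_integrable_sq_norm hc.1).1 hc)
      (Filter.Eventually.of_forall fun _ => by positivity)]
  simp

theorem tsum_enorm_inner_whSystem {f g : ℝ → ℂ} (hf : MemLp f 2 volume) (hg : MemLp g 2 volume)
    (hc : ∀ n, MemLp (latticeCorr f g n) 2 (volume.restrict (Ioc (0 : ℝ) 1))) :
    ∑' p, ‖inner ℂ (hf.toLp f) (whSystem g hg 1 1 p)‖ₑ ^ 2 =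
      ∫⁻ t in Ioc (0 : ℝ) 1, ∑' n : ℤ, ‖latticeCorr f g n t‖ₑ ^ 2 := by
  rw [ENNReal.tsum_prod (f := fun m n =>
    ‖inner ℂ (hf.toLp f) (whSystem g hg 1 1 (m, n))‖ₑ ^ 2), ENNReal.tsum_comm,
    lintegral_tsum fun n => (hc n).1.enorm.pow_const 2]
  refine tsum_congr fun n => ?_
  simp_rw [inner_whSystem_eq_fourierCoeffOn]
  rw [← tsum_enorm_fourierCoeffOn (hc n)]
  exact (Equiv.neg ℤ).tsum_eq
    fun m => ‖fourierCoeffOn (zero_lt_one (α := ℝ)) (latticeCorr f g n) m‖ₑ ^ 2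

theorem enorm_toLp_sq_eq_lintegral {f : ℝ → ℂ} (hf : MemLp f 2 volume) :
    ‖hf.toLp f‖ₑ ^ 2 = ∫⁻ t in Ioc (0 : ℝ) 1, ∑' j : ℤ, ‖f (t + j)‖ₑ ^ 2 := by
  rw [lintegral_Ioc_tsum_add_int (h := fun t => ‖f t‖ₑ ^ 2) (hf.1.enorm.pow_const 2),
    Lp.enorm_toLp, eLpNorm_eq_lintegral_rpow_enorm_toReal two_ne_zero ENNReal.ofNat_ne_top]
  rw [← ENNReal.rpow_natCast, ← ENNReal.rpow_mul]
  simp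

/-- In [0,∞] the summability clause is absorbed by the upper bound, and integrals and sums can be
exchanged freely. -/
theorem isFrame_iff_enorm {ι H : Type*} [NormedAddCommGroup H] [InnerProductSpace ℂ H]
    {f : ι → H} :
    IsFrame f ↔ ∃ A B : ℝ, 0 < A ∧ 0 ≤ B ∧ ∀ x : H,
      ENNReal.ofReal A * ‖x‖ₑ ^ 2 ≤ ∑' i, ‖inner ℂ x (f i)‖ₑ ^ 2 ∧
      ∑' i, ‖inner ℂ x (f i)‖ₑ ^ 2 ≤ ENNReal.ofReal B * ‖x‖ₑ ^ 2 := by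
  simp_rw [enorm_sq_eq_ofReal]
  constructor
  · rintro ⟨A, B, hA, h⟩
    refine ⟨A, max B 0, hA, le_max_right _ _, fun x => ?_⟩
    obtain ⟨hs, h1, h2⟩ := h x
    rw [← ENNReal.ofReal_tsum_of_nonneg (fun _ => by positivity) hs,
      ← ENNReal.ofReal_mul hA.le, ← ENNReal.ofReal_mul (le_max_right _ _)]
    refine ⟨ENNReal.ofReal_le_ofReal h1, ENNReal.ofReal_le_ofReal (h2.trans ?_)⟩
    gcongr
    exact le_max_left _ _
  · rintro ⟨A, B, hA, hB, h⟩
    refine ⟨A, B, hA, fun x => ?_⟩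
    obtain ⟨h1, h2⟩ := h x
    rw [← ENNReal.ofReal_mul hB] at h2
    rw [← ENNReal.ofReal_mul hA.le] at h1
    have hs : Summable fun i => ‖inner ℂ x (f i)‖ ^ 2 := by
      have := ENNReal.summable_toReal (h2.trans_lt ENNReal.ofReal_lt_top).ne
      refine this.congr fun i => ENNReal.toReal_ofReal (by positivity)
    rw [← ENNReal.ofReal_tsum_of_nonneg (fun _ => by positivity) hs] at h1 h2
    exact ⟨hs, (ENNReal.ofReal_le_ofReal_iff (tsum_nonneg fun _ => by positivity)).1 h1,
      (ENNReal.ofReal_le_ofReal_iff (by positivity)).1 h2⟩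

/-! ### From frame bounds to fibrewise bounds -/

/-- The step function with value `F j` on `E + j` for `j ∈ s`. -/
noncomputable def latticeStep (E : Set ℝ) (s : Finset ℤ) (F : ℤ → ℂ) (x : ℝ) : ℂ :=
  ∑ j ∈ s, E.indicator (fun _ => F j) (x - j)

theorem memLp_latticeStep {E : Set ℝ} (hE : MeasurableSet E) (hE1 : E ⊆ Ioc 0 1)
    (s : Finset ℤ) (F : ℤ → ℂ) : MemLp (latticeStep E s F) 2 volume := by
  refine memLp_finsetSum s fun j _ => ?_
  have hfin : volume E ≠ ∞ := ((measure_mono hE1).trans_lt (by simp)).ne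
  exact (memLp_indicator_const 2 hE (F j) (Or.inr hfin)).comp_measurePreserving
    (measurePreserving_sub_right volume (j : ℝ))

theorem latticeStep_add_int {E : Set ℝ} (hE1 : E ⊆ Ioc 0 1) (s : Finset ℤ) (F : ℤ → ℂ)
    {t : ℝ} (ht : t ∈ Ioc (0 : ℝ) 1) (i : ℤ) :
    latticeStep E s F (t + i) = E.indicator (fun _ => (s : Set ℤ).indicator F i) t := by
  -- Two points of (0,1] cannot differ by a nonzero integer.
  have hne : ∀ j : ℤ, j ≠ i → t + i - j ∉ E := fun j hj hmem => by
    have h := hE1 hmem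
    rcases lt_or_gt_of_ne hj with h' | h'
    · have : (j : ℝ) + 1 ≤ i := by exact_mod_cast h'
      linarith [h.2, ht.1]
    · have : (i : ℝ) + 1 ≤ j := by exact_mod_cast h'
      linarith [h.1, ht.2]
  unfold latticeStep
  by_cases hi : i ∈ s
  · rw [Finset.sum_eq_single_of_mem i hi fun j _ hj => indicator_of_notMem (hne j hj) _]
    simp [hi]
  · rw [Finset.sum_eq_zero fun j hj =>
      indicator_of_notMem (hne j (ne_of_mem_of_not_mem hj hi)) _]
    simp [hi]

theorem latticeCorr_latticeStep {E : Set ℝ} (hE1 : E ⊆ Ioc 0 1) (s : Finset ℤ) (F : ℤ → ℂ)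
    (g : ℝ → ℂ) {t : ℝ} (ht : t ∈ Ioc (0 : ℝ) 1) (n : ℤ) :
    latticeCorr (latticeStep E s F) g n t =
      E.indicator (fun t => ∑ j ∈ s, conj (F j) * g (t + j - n)) t := by
  unfold latticeCorr
  simp_rw [latticeStep_add_int hE1 s F ht]
  rw [tsum_eq_sum (s := s) fun j hj => by simp [hj]]
  by_cases hE : t ∈ E
  · simp only [indicator_of_mem hE]
    exact Finset.sum_congr rfl fun j hj => by simp [hj]
  · simp [hE]

theorem tsum_enorm_latticeStep {E : Set ℝ} (hE1 : E ⊆ Ioc 0 1) (s : Finset ℤ) (F : ℤ → ℂ)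
    {t : ℝ} (ht : t ∈ Ioc (0 : ℝ) 1) :
    ∑' j : ℤ, ‖latticeStep E s F (t + j)‖ₑ ^ 2 =
      E.indicator (fun _ => ∑ j ∈ s, ‖F j‖ₑ ^ 2) t := by
  simp_rw [latticeStep_add_int hE1 s F ht]
  rw [tsum_eq_sum (s := s) fun j hj => by simp [hj]]
  by_cases hE : t ∈ E
  · simp only [indicator_of_mem hE]
    exact Finset.sum_congr rfl fun j hj => by simp [hj]
  · simp [hE]

theorem memLp_sum_mul_translate {g : ℝ → ℂ} (hg : MemLp g 2 volume) (s : Finset ℤ) (F : ℤ → ℂ)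
    (n : ℤ) : MemLp (fun t : ℝ => ∑ j ∈ s, conj (F j) * g (t + j - n)) 2 volume := by
  refine memLp_finsetSum s fun j _ => MemLp.const_mul ?_ _
  simp_rw [add_sub_assoc]
  exact hg.comp_measurePreserving (measurePreserving_add_right volume ((j : ℝ) - n))

/-- The frame inequalities for a Weyl–Heisenberg system over `ℤ × ℤ` hold fibrewise. -/
theorem ae_fibre_bounds_of_frame_bounds {g : ℝ → ℂ} (hg : MemLp g 2 volume) {A B : ℝ}
    (h : ∀ x : Lp ℂ 2 (volume : Measure ℝ),
      ENNReal.ofReal A * ‖x‖ₑ ^ 2 ≤ ∑' i, ‖inner ℂ x (whSystem g hg 1 1 i)‖ₑ ^ 2 ∧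
      ∑' i, ‖inner ℂ x (whSystem g hg 1 1 i)‖ₑ ^ 2 ≤ ENNReal.ofReal B * ‖x‖ₑ ^ 2)
    (s : Finset ℤ) (F : ℤ → ℂ) :
    ∀ᵐ t ∂(volume.restrict (Ioc (0 : ℝ) 1)),
      ENNReal.ofReal A * ∑ j ∈ s, ‖F j‖ₑ ^ 2 ≤
        ∑' n : ℤ, ‖∑ j ∈ s, conj (F j) * g (t + j - n)‖ₑ ^ 2 ∧
      ∑' n : ℤ, ‖∑ j ∈ s, conj (F j) * g (t + j - n)‖ₑ ^ 2 ≤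
        ENNReal.ofReal B * ∑ j ∈ s, ‖F j‖ₑ ^ 2 := by
  set Φ : ℝ → ℝ≥0∞ := fun t => ∑' n : ℤ, ‖∑ j ∈ s, conj (F j) * g (t + j - n)‖ₑ ^ 2 with hΦ
  have hΦm : AEMeasurable Φ (volume.restrict (Ioc (0 : ℝ) 1)) :=
    AEMeasurable.tsum fun n =>
      ((memLp_sum_mul_translate hg s F n).1.enorm.pow_const 2).restrict
  -- Step functions over D ∩ (0,1] give the inequality integrated over D. Since D is arbitrary, it
  -- then holds almost everywhere.
  have key : ∀ D : Set ℝ, MeasurableSet D →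
      ENNReal.ofReal A * ∫⁻ _ in D, ∑ j ∈ s, ‖F j‖ₑ ^ 2 ∂(volume.restrict (Ioc (0 : ℝ) 1)) ≤
        ∫⁻ t in D, Φ t ∂(volume.restrict (Ioc (0 : ℝ) 1)) ∧
      ∫⁻ t in D, Φ t ∂(volume.restrict (Ioc (0 : ℝ) 1)) ≤
        ENNReal.ofReal B * ∫⁻ _ in D, ∑ j ∈ s, ‖F j‖ₑ ^ 2 ∂(volume.restrict (Ioc (0 : ℝ) 1)) := by
    intro D hD
    set E := D ∩ Ioc (0 : ℝ) 1 with hEdef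
    have hE : MeasurableSet E := hD.inter measurableSet_Ioc
    have hE1 : E ⊆ Ioc (0 : ℝ) 1 := inter_subset_right
    have hf := memLp_latticeStep hE hE1 s F
    have hc : ∀ n, MemLp (latticeCorr (latticeStep E s F) g n) 2
        (volume.restrict (Ioc (0 : ℝ) 1)) := fun n => by
      refine MemLp.ae_eq ?_ (((memLp_sum_mul_translate hg s F n).indicator hE).restrict _)
      filter_upwards [ae_restrict_mem measurableSet_Ioc] with t ht
      exact (latticeCorr_latticeStep hE1 s F g ht n).symm
    have h1 := h (hf.toLp _)
    rw [tsum_enorm_inner_whSystem hf hg hc, enorm_toLp_sq_eq_lintegral hf] at h1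
    have h2 : ∫⁻ t in Ioc (0 : ℝ) 1, ∑' n : ℤ, ‖latticeCorr (latticeStep E s F) g n t‖ₑ ^ 2 =
        ∫⁻ t in D, Φ t ∂(volume.restrict (Ioc (0 : ℝ) 1)) := by
      rw [← lintegral_indicator hD]
      refine setLIntegral_congr_fun measurableSet_Ioc fun t ht => ?_
      simp_rw [latticeCorr_latticeStep hE1 s F g ht]
      by_cases htD : t ∈ D
      · have : t ∈ E := ⟨htD, ht⟩
        simp [htD, this, hΦ]
      · have : t ∉ E := fun h => htD h.1
        simp [htD, this]
    have h3 : ∫⁻ t in Ioc (0 : ℝ) 1, ∑' j : ℤ, ‖latticeStep E s F (t + j)‖ₑ ^ 2 =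
        ∫⁻ _ in D, ∑ j ∈ s, ‖F j‖ₑ ^ 2 ∂(volume.restrict (Ioc (0 : ℝ) 1)) := by
      rw [← lintegral_indicator hD]
      refine setLIntegral_congr_fun measurableSet_Ioc fun t ht => ?_
      simp_rw [tsum_enorm_latticeStep hE1 s F ht]
      by_cases htD : t ∈ D
      · have : t ∈ E := ⟨htD, ht⟩
        simp [htD, this]
      · have : t ∉ E := fun h => htD h.1
        simp [htD, this]
    rwa [h2, h3] at h1
  have hlow := ae_le_of_forall_setLIntegral_le_of_sigmaFinite₀
    (μ := volume.restrict (Ioc (0 : ℝ) 1))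
    (f := fun _ => ENNReal.ofReal A * ∑ j ∈ s, ‖F j‖ₑ ^ 2) (g := Φ)
    aemeasurable_const fun D hD _ => by
      rw [lintegral_const_mul' _ _ ENNReal.ofReal_ne_top]
      exact (key D hD).1
  have hup := ae_le_of_forall_setLIntegral_le_of_sigmaFinite₀
    (μ := volume.restrict (Ioc (0 : ℝ) 1))
    (f := Φ) (g := fun _ => ENNReal.ofReal B * ∑ j ∈ s, ‖F j‖ₑ ^ 2)
    hΦm fun D hD _ => by
      rw [lintegral_const_mul' _ _ ENNReal.ofReal_ne_top]
      exact (key D hD).2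
  filter_upwards [hlow, hup] with t h1 h2 using ⟨h1, h2⟩

/-! ### Two-point cosets and sufficiency of separation -/

/-- On the coset `t + ℤ` the function `g` vanishes off the two points `t - p` and `t - q`. -/
def IsSupportedAtPair (g : ℝ → ℂ) (t : ℝ) (p q : ℤ) : Prop :=
  p ≠ q ∧ ∀ n : ℤ, n ≠ p → n ≠ q → g (t - n) = 0

theorem IsSupportedAtPair.hasSum_mul {g : ℝ → ℂ} {t : ℝ} {p q : ℤ}
    (h : IsSupportedAtPair g t p q) (a : ℤ → ℂ) (n : ℤ) :
    HasSum (fun j : ℤ => a j * g (t + j - n))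
      (a (n - p) * g (t - p) + a (n - q) * g (t - q)) := by
  have hpq : n - p ≠ n - q := fun h' => h.1 (by omega)
  have h0 : ∀ j ∉ ({n - p, n - q} : Finset ℤ), a j * g (t + j - n) = 0 := fun j hj => by
    simp only [Finset.mem_insert, Finset.mem_singleton, not_or] at hj
    have := h.2 (n - j) (by omega) (by omega)
    push_cast at this
    rw [show t + j - n = t - (n - j) by ring, this, mul_zero]
  have h1 : HasSum (fun j : ℤ => a j * g (t + j - n)) _ := hasSum_sum_of_ne_finset_zero h0
  rw [Finset.sum_pair hpq] at h1
  convert h1 using 4 <;> push_cast <;> ring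

theorem IsSupportedAtPair.latticeCorr_eq {g : ℝ → ℂ} {t : ℝ} {p q : ℤ}
    (h : IsSupportedAtPair g t p q) (f : ℝ → ℂ) (n : ℤ) :
    latticeCorr f g n t = conj (f (t + (n - p : ℤ))) * g (t - p) +
      conj (f (t + (n - q : ℤ))) * g (t - q) :=
  (h.hasSum_mul (fun j : ℤ => conj (f (t + j))) n).tsum_eq

/-- With a, b the moduli of the two coefficients, 2ab ≤ a² + b² gives (a|x|-b|y|)² ≥ |x|(|x|-|y|)a²
+ |y|(|y|-|x|)b². Summed over `n`, the right side becomes (|x|-|y|)² ∑|αⱼ|². -/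
theorem tsum_enorm_two_term_bounds (α : ℤ → ℂ) (hα : ∑' j, ‖α j‖ₑ ^ 2 ≠ ∞) (x y : ℂ) (p q : ℤ) :
    ENNReal.ofReal ((‖x‖ - ‖y‖) ^ 2) * ∑' j, ‖α j‖ₑ ^ 2 ≤
      ∑' n : ℤ, ‖conj (α (n - p)) * x + conj (α (n - q)) * y‖ₑ ^ 2 ∧
    ∑' n : ℤ, ‖conj (α (n - p)) * x + conj (α (n - q)) * y‖ₑ ^ 2 ≤
      ENNReal.ofReal (2 * (‖x‖ ^ 2 + ‖y‖ ^ 2)) * ∑' j, ‖α j‖ₑ ^ 2 := by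
  have hs : Summable fun j => ‖α j‖ ^ 2 := by
    simp_rw [enorm_sq_eq_ofReal] at hα
    exact (ENNReal.summable_toReal hα).congr fun i => ENNReal.toReal_ofReal (by positivity)
  set S := ∑' j, ‖α j‖ ^ 2
  have hsh : ∀ r : ℤ, HasSum (fun n : ℤ => ‖α (n - r)‖ ^ 2) S := fun r =>
    (Equiv.subRight r).hasSum_iff (f := fun j => ‖α j‖ ^ 2) |>.2 hs.hasSum
  set c : ℤ → ℂ := fun n => conj (α (n - p)) * x + conj (α (n - q)) * y with hc
  have hup : ∀ n, ‖c n‖ ^ 2 ≤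
      2 * ‖x‖ ^ 2 * ‖α (n - p)‖ ^ 2 + 2 * ‖y‖ ^ 2 * ‖α (n - q)‖ ^ 2 := fun n => by
    have h1 : ‖c n‖ ≤ ‖α (n - p)‖ * ‖x‖ + ‖α (n - q)‖ * ‖y‖ := by
      refine (norm_add_le _ _).trans_eq ?_
      simp
    have h2 : ‖c n‖ ^ 2 ≤ (‖α (n - p)‖ * ‖x‖ + ‖α (n - q)‖ * ‖y‖) ^ 2 := by gcongr
    linarith [sq_nonneg (‖α (n - p)‖ * ‖x‖ - ‖α (n - q)‖ * ‖y‖)]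
  have hlow : ∀ n, ‖x‖ * (‖x‖ - ‖y‖) * ‖α (n - p)‖ ^ 2 +
      ‖y‖ * (‖y‖ - ‖x‖) * ‖α (n - q)‖ ^ 2 ≤ ‖c n‖ ^ 2 := fun n => by
    have h1 : |‖α (n - p)‖ * ‖x‖ - ‖α (n - q)‖ * ‖y‖| ≤ ‖c n‖ := by
      have := abs_norm_sub_norm_le (conj (α (n - p)) * x) (-(conj (α (n - q)) * y))
      simpa [hc] using this
    have h2 : (‖α (n - p)‖ * ‖x‖ - ‖α (n - q)‖ * ‖y‖) ^ 2 ≤ ‖c n‖ ^ 2 :=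
      sq_le_sq' (by linarith [neg_abs_le (‖α (n - p)‖ * ‖x‖ - ‖α (n - q)‖ * ‖y‖)])
        ((le_abs_self _).trans h1)
    have h3 : 0 ≤ ‖x‖ * ‖y‖ * (‖α (n - p)‖ - ‖α (n - q)‖) ^ 2 := by positivity
    linarith
  have hsup := ((hsh p).mul_left (2 * ‖x‖ ^ 2)).add ((hsh q).mul_left (2 * ‖y‖ ^ 2))
  have hslow := ((hsh p).mul_left (‖x‖ * (‖x‖ - ‖y‖))).add
    ((hsh q).mul_left (‖y‖ * (‖y‖ - ‖x‖)))
  have hsc : Summable fun n => ‖c n‖ ^ 2 :=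
    Summable.of_nonneg_of_le (fun _ => by positivity) hup hsup.summable
  have h1 := hasSum_le hlow hslow hsc.hasSum
  have h2 := hasSum_le hup hsc.hasSum hsup
  simp_rw [enorm_sq_eq_ofReal]
  rw [← ENNReal.ofReal_tsum_of_nonneg (fun _ => by positivity) hs,
    ← ENNReal.ofReal_tsum_of_nonneg (fun _ => by positivity) hsc,
    ← ENNReal.ofReal_mul (by positivity), ← ENNReal.ofReal_mul (by positivity)]
  exact ⟨ENNReal.ofReal_le_ofReal (by linarith), ENNReal.ofReal_le_ofReal (by linarith)⟩

/-- Almost every coset of `ℤ` carries at most two values of `g`, whose moduli are uniformly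
separated and bounded. -/
def HasSeparatedPairs (g : ℝ → ℂ) : Prop :=
  ∃ A B : ℝ, 0 < A ∧ ∀ᵐ t : ℝ, ∃ p q : ℤ, IsSupportedAtPair g t p q ∧
    A ≤ (‖g (t - p)‖ - ‖g (t - q)‖) ^ 2 ∧ ‖g (t - p)‖ ^ 2 + ‖g (t - q)‖ ^ 2 ≤ B

theorem HasSeparatedPairs.isWHFrame {g : ℝ → ℂ} (hg : MemLp g 2 volume)
    (h : HasSeparatedPairs g) : IsWHFrame g hg 1 1 := by
  obtain ⟨A, B, hA, h⟩ := h
  refine isFrame_iff_enorm.2 ⟨A, 2 * max B 0, hA, by positivity, fun x => ?_⟩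
  obtain ⟨f, hf, rfl⟩ : ∃ (f : ℝ → ℂ) (hf : MemLp f 2 volume), hf.toLp f = x :=
    ⟨x, Lp.memLp x, Lp.toLp_coeFn x _⟩
  have hfj : ∀ a : ℝ, AEStronglyMeasurable (fun t : ℝ => f (t + a)) volume := fun a =>
    hf.1.comp_quasiMeasurePreserving (quasiMeasurePreserving_add_const a)
  have hSm : AEMeasurable (fun t : ℝ => ∑' j : ℤ, ‖f (t + j)‖ₑ ^ 2)
      (volume.restrict (Ioc (0 : ℝ) 1)) :=
    AEMeasurable.tsum fun j => ((hfj j).enorm.pow_const 2).restrict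
  have hSint : ∫⁻ t in Ioc (0 : ℝ) 1, ∑' j : ℤ, ‖f (t + j)‖ₑ ^ 2 ≠ ∞ := by
    rw [← enorm_toLp_sq_eq_lintegral hf]
    exact ENNReal.pow_ne_top enorm_ne_top
  have hpt : ∀ᵐ t ∂(volume.restrict (Ioc (0 : ℝ) 1)),
      (∀ n : ℤ, Summable fun j : ℤ => conj (f (t + j)) * g (t + j - n)) ∧
      ENNReal.ofReal A * ∑' j : ℤ, ‖f (t + j)‖ₑ ^ 2 ≤
        ∑' n : ℤ, ‖latticeCorr f g n t‖ₑ ^ 2 ∧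
      ∑' n : ℤ, ‖latticeCorr f g n t‖ₑ ^ 2 ≤
        ENNReal.ofReal (2 * max B 0) * ∑' j : ℤ, ‖f (t + j)‖ₑ ^ 2 := by
    filter_upwards [ae_restrict_of_ae h, ae_lt_top' hSm hSint] with t ⟨p, q, hpq, hA', hB'⟩ hfin
    have h1 := tsum_enorm_two_term_bounds (fun j : ℤ => f (t + j)) hfin.ne (g (t - p)) (g (t - q)) p q
    simp_rw [hpq.latticeCorr_eq]
    refine ⟨fun n => (hpq.hasSum_mul (fun j : ℤ => conj (f (t + j))) n).summable,
      le_trans ?_ h1.1, h1.2.trans ?_⟩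
    · gcongr
    · gcongr
      exact hB'.trans (le_max_left _ _)
  have hup : ∫⁻ t in Ioc (0 : ℝ) 1, ∑' n : ℤ, ‖latticeCorr f g n t‖ₑ ^ 2 ≤
      ENNReal.ofReal (2 * max B 0) * ∫⁻ t in Ioc (0 : ℝ) 1, ∑' j : ℤ, ‖f (t + j)‖ₑ ^ 2 := by
    rw [← lintegral_const_mul' _ _ ENNReal.ofReal_ne_top]
    exact lintegral_mono_ae (hpt.mono fun t ht => ht.2.2)
  have hlow : ENNReal.ofReal A * ∫⁻ t in Ioc (0 : ℝ) 1, ∑' j : ℤ, ‖f (t + j)‖ₑ ^ 2 ≤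
      ∫⁻ t in Ioc (0 : ℝ) 1, ∑' n : ℤ, ‖latticeCorr f g n t‖ₑ ^ 2 := by
    rw [← lintegral_const_mul' _ _ ENNReal.ofReal_ne_top]
    exact lintegral_mono_ae (hpt.mono fun t ht => ht.2.1)
  -- Parseval needs each correlation in L²: it is an a.e. limit of finite sums, and its norm is one
  -- term of the bound `hup`.
  have hc : ∀ n, MemLp (latticeCorr f g n) 2 (volume.restrict (Ioc (0 : ℝ) 1)) := fun n => by
    refine ⟨?_, ?_⟩
    · refine aestronglyMeasurable_of_tendsto_ae (Filter.atTop : Filter (Finset ℤ))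
        (f := fun (s : Finset ℤ) (t : ℝ) => ∑ j ∈ s, conj (f (t + j)) * g (t + j - n))
        (fun s => ?_) (hpt.mono fun t ht => (ht.1 n).hasSum)
      refine Finset.aestronglyMeasurable_fun_sum s fun j _ => ?_
      refine AEStronglyMeasurable.restrict (AEStronglyMeasurable.mul (hfj j).star ?_)
      simp_rw [add_sub_assoc]
      exact hg.1.comp_quasiMeasurePreserving (quasiMeasurePreserving_add_const _)
    · rw [eLpNorm_lt_top_iff_lintegral_rpow_enorm_lt_top two_ne_zero ENNReal.ofNat_ne_top]
      simp only [ENNReal.toReal_ofNat, ENNReal.rpow_ofNat]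
      refine lt_of_le_of_lt (lintegral_mono fun t => ?_)
        (hup.trans_lt (ENNReal.mul_lt_top ENNReal.ofReal_lt_top hSint.lt_top))
      exact ENNReal.le_tsum (f := fun n : ℤ => ‖latticeCorr f g n t‖ₑ ^ 2) n
  rw [tsum_enorm_inner_whSystem hf hg hc, enorm_toLp_sq_eq_lintegral hf]
  exact ⟨hlow, hup⟩

theorem ae_of_ae_restrict_Ioc_of_translate {P : ℝ → Prop} (hP : ∀ t (j : ℤ), P (t + j) → P t)
    (h : ∀ᵐ t ∂(volume.restrict (Ioc (0 : ℝ) 1)), P t) : ∀ᵐ t : ℝ, P t := by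
  rw [ae_restrict_iff' measurableSet_Ioc] at h
  have h' : ∀ᵐ t : ℝ, ∀ j : ℤ, t + j ∈ Ioc (0 : ℝ) 1 → P (t + j) :=
    ae_all_iff.2 fun j => (quasiMeasurePreserving_add_const (j : ℝ)).ae h
  filter_upwards [h'] with t ht
  -- The shift 1 - ⌈t⌉ brings t into (0,1].
  refine hP t (1 - ⌈t⌉) (ht _ ?_)
  push_cast
  constructor
  · linarith [Int.ceil_lt_add_one t]
  · linarith [Int.le_ceil t]

/-- The support is enlarged to exactly two indices, so cosets with fewer nonzero values need no
separate treatment. -/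
theorem exists_isSupportedAtPair {g : ℝ → ℂ} {t : ℝ} (h : {n : ℤ | g (t - n) ≠ 0}.encard ≤ 2) :
    ∃ p q : ℤ, IsSupportedAtPair g t p q := by
  obtain ⟨r, hr, -, hr2⟩ := exists_superset_subset_encard_eq (subset_univ _) h
    (by simp [encard_eq_top infinite_univ])
  obtain ⟨p, q, hpq, rfl⟩ := encard_eq_two.1 hr2
  refine ⟨p, q, hpq, fun n hp hq => ?_⟩
  by_contra hn
  rcases hr hn with h | h
  exacts [hp h, hq h]

theorem IsSupportedAtPair.of_add_int {g : ℝ → ℂ} {t : ℝ} {j p q : ℤ}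
    (h : IsSupportedAtPair g (t + j) p q) : IsSupportedAtPair g t (p - j) (q - j) := by
  refine ⟨fun h' => h.1 (by omega), fun n hp hq => ?_⟩
  have := h.2 (n + j) (by omega) (by omega)
  push_cast at this
  rwa [show t + j - (n + j) = t - n by ring] at this

theorem IsSupportedAtPair.symm {g : ℝ → ℂ} {t : ℝ} {p q : ℤ} (h : IsSupportedAtPair g t p q) :
    IsSupportedAtPair g t q p :=
  ⟨h.1.symm, fun n hq hp => h.2 n hp hq⟩

/-! ### The correlations G_k on a two-point coset -/

namespace IsSupportedAtPair

variable {g : ℝ → ℂ} {t : ℝ} {p q : ℤ}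

theorem whG_eq (h : IsSupportedAtPair g t p q) (k : ℤ) :
    whG g 1 1 k t = g (t - p) * conj (g (t - (p + k : ℤ))) +
      g (t - q) * conj (g (t - (q + k : ℤ))) := by
  unfold whG
  rw [tsum_eq_sum (s := {p, q}) fun n hn => by
    simp only [Finset.mem_insert, Finset.mem_singleton, not_or] at hn
    simp [h.2 n hn.1 hn.2], Finset.sum_pair h.1]
  push_cast
  simp [sub_sub]

theorem whG_zero (h : IsSupportedAtPair g t p q) :
    whG g 1 1 0 t = ((‖g (t - p)‖ ^ 2 + ‖g (t - q)‖ ^ 2 : ℝ) : ℂ) := by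
  rw [h.whG_eq]
  simp [Complex.mul_conj, Complex.normSq_eq_norm_sq]

theorem whG_zero_re (h : IsSupportedAtPair g t p q) :
    (whG g 1 1 0 t).re = ‖g (t - p)‖ ^ 2 + ‖g (t - q)‖ ^ 2 := by
  rw [h.whG_zero, Complex.ofReal_re]

theorem norm_whG_zero (h : IsSupportedAtPair g t p q) :
    ‖whG g 1 1 0 t‖ = ‖g (t - p)‖ ^ 2 + ‖g (t - q)‖ ^ 2 := by
  rw [h.whG_zero, Complex.norm_of_nonneg (by positivity)]

theorem norm_whG_sub (h : IsSupportedAtPair g t p q) :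
    ‖whG g 1 1 (q - p) t‖ = ‖g (t - p)‖ * ‖g (t - q)‖ := by
  have hne := h.1
  rw [h.whG_eq, h.2 (q + (q - p)) (by omega) (by omega)]
  simp

theorem whG_eq_zero (h : IsSupportedAtPair g t p q) {k : ℤ} (h0 : k ≠ 0) (h1 : k ≠ q - p)
    (h2 : k ≠ p - q) : whG g 1 1 k t = 0 := by
  rw [h.whG_eq, h.2 (p + k) (by omega) (by omega), h.2 (q + k) (by omega) (by omega)]
  simp

theorem tsum_norm_whG_ne_zero (h : IsSupportedAtPair g t p q) :
    ∑' k : {k : ℤ // k ≠ 0}, ‖whG g 1 1 k t‖ = 2 * (‖g (t - p)‖ * ‖g (t - q)‖) := by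
  have hne := h.1
  have h1 := tsum_subtype {k : ℤ | k ≠ 0} fun k => ‖whG g 1 1 k t‖
  refine h1.trans ?_
  rw [tsum_eq_sum (s := {q - p, p - q}) fun k hk => ?_, Finset.sum_pair (by omega),
    indicator_of_mem (by simp only [mem_ofPred_eq]; omega),
    indicator_of_mem (by simp only [mem_ofPred_eq]; omega), h.norm_whG_sub, h.symm.norm_whG_sub]
  · ring
  · simp only [Finset.mem_insert, Finset.mem_singleton, not_or] at hk
    by_cases hk0 : k = 0
    · simp [hk0]
    · simp [h.whG_eq_zero hk0 hk.1 hk.2]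

theorem hasSum_norm_whG (h : IsSupportedAtPair g t p q) :
    HasSum (fun k : ℤ => ‖whG g 1 1 k t‖) ((‖g (t - p)‖ + ‖g (t - q)‖) ^ 2) := by
  have hne := h.1
  have h0 : ∀ k ∉ ({0, q - p, p - q} : Finset ℤ), ‖whG g 1 1 k t‖ = 0 := fun k hk => by
    simp only [Finset.mem_insert, Finset.mem_singleton, not_or] at hk
    rw [h.whG_eq_zero hk.1 hk.2.1 hk.2.2, norm_zero]
  have h1 : HasSum (fun k : ℤ => ‖whG g 1 1 k t‖) _ := hasSum_sum_of_ne_finset_zero h0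
  rw [Finset.sum_insert (by simp only [Finset.mem_insert, Finset.mem_singleton]; omega),
    Finset.sum_pair (by omega), h.norm_whG_zero, h.norm_whG_sub, h.symm.norm_whG_sub] at h1
  convert h1 using 1
  ring

end IsSupportedAtPair

/-! ### Separation versus conditions (2) and (3) -/

theorem hasSeparatedPairs_of_ae_restrict {g : ℝ → ℂ} {A B : ℝ} (hA : 0 < A)
    (h : ∀ᵐ t ∂(volume.restrict (Ioc (0 : ℝ) 1)), ∃ p q : ℤ, IsSupportedAtPair g t p q ∧
      A ≤ (‖g (t - p)‖ - ‖g (t - q)‖) ^ 2 ∧ ‖g (t - p)‖ ^ 2 + ‖g (t - q)‖ ^ 2 ≤ B) :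
    HasSeparatedPairs g := by
  refine ⟨A, B, hA, ae_of_ae_restrict_Ioc_of_translate (fun t j ⟨p, q, hpq, h⟩ => ?_) h⟩
  refine ⟨p - j, q - j, hpq.of_add_int, ?_⟩
  have he : ∀ n : ℤ, t - (n - j : ℤ) = t + j - n := fun n => by push_cast; ring
  simpa only [he] using h

theorem hasSeparatedPairs_iff_ccCondition {g : ℝ → ℂ}
    (htwo : ∀ᵐ t ∂(volume.restrict (Ioc (0 : ℝ) 1)), ∃ p q, IsSupportedAtPair g t p q) :
    HasSeparatedPairs g ↔ CCCondition g 1 1 := by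
  unfold CCCondition
  rw [← restrict_Ioc_eq_restrict_Icc]
  constructor
  · rintro ⟨A, B, hA, h⟩
    -- The factor 2 comes from (|x|+|y|)² ≤ 2(|x|²+|y|²).
    refine ⟨⟨2 * B, ?_⟩, A, hA, ?_⟩
    · filter_upwards [ae_restrict_of_ae h] with t ⟨p, q, hpq, h1, h2⟩
      refine ⟨hpq.hasSum_norm_whG.summable, ?_⟩
      rw [hpq.hasSum_norm_whG.tsum_eq]
      linarith [sq_nonneg (‖g (t - p)‖ - ‖g (t - q)‖)]
    · filter_upwards [ae_restrict_of_ae h] with t ⟨p, q, hpq, h1, h2⟩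
      rw [hpq.tsum_norm_whG_ne_zero, hpq.whG_zero_re]
      linarith
  · rintro ⟨⟨B, hB⟩, A, hA, h⟩
    refine hasSeparatedPairs_of_ae_restrict (B := B) hA ?_
    filter_upwards [htwo, hB, h] with t ⟨p, q, hpq⟩ h1 h2
    rw [hpq.tsum_norm_whG_ne_zero, hpq.whG_zero_re] at h2
    have h3 := h1.2
    rw [hpq.hasSum_norm_whG.tsum_eq] at h3
    refine ⟨p, q, hpq, by linarith, ?_⟩
    have : 0 ≤ ‖g (t - p)‖ * ‖g (t - q)‖ := by positivity
    linarith

theorem hasSeparatedPairs_iff_values_separated {g : ℝ → ℂ}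
    (htwo : ∀ᵐ t ∂(volume.restrict (Ioc (0 : ℝ) 1)), ∃ p q, IsSupportedAtPair g t p q) :
    HasSeparatedPairs g ↔
      (∃ A B : ℝ, 0 < A ∧
        ∀ᵐ t : ℝ, A ≤ (whG g 1 1 0 t).re ∧ (whG g 1 1 0 t).re ≤ B) ∧
      (∃ A : ℝ, 0 < A ∧
        ∀ᵐ t : ℝ, g t ≠ 0 → ∀ n : ℤ, n ≠ 0 → g (t - n) ≠ 0 →
          A ≤ |‖g t‖ - ‖g (t - n)‖|) := by
  constructor
  · rintro ⟨A, B, hA, h⟩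
    refine ⟨⟨A, B, hA, ?_⟩, √A, Real.sqrt_pos.2 hA, ?_⟩
    · filter_upwards [h] with t ⟨p, q, hpq, h1, h2⟩
      rw [hpq.whG_zero_re]
      have : 0 ≤ ‖g (t - p)‖ * ‖g (t - q)‖ := by positivity
      exact ⟨by linarith, h2⟩
    · filter_upwards [h] with t ⟨p, q, hpq, h1, h2⟩ h0 n hn hgn
      have hm : ∀ m : ℤ, g (t - m) ≠ 0 → m = p ∨ m = q := fun m hm => by
        by_contra! hc
        exact hm (hpq.2 m hc.1 hc.2)
      have h0' : g (t - (0 : ℤ)) ≠ 0 := by simpa using h0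
      refine Real.sqrt_le_sqrt h1 |>.trans_eq ?_
      rw [Real.sqrt_sq_eq_abs]
      rcases hm 0 h0' with rfl | rfl <;> rcases hm n hgn with rfl | rfl
      · exact absurd rfl hn
      · simp
      · rw [abs_sub_comm]
        simp
      · exact absurd rfl hn
  · rintro ⟨⟨A, B, hA, h⟩, A', hA', h'⟩
    refine hasSeparatedPairs_of_ae_restrict (A := min A (A' ^ 2)) (B := B)
      (lt_min hA (by positivity)) ?_
    -- Condition (3) is needed at the point t - p, with shift q - p, where p depends on t; hence all
    -- integer translates at once.
    have hall : ∀ᵐ t : ℝ, ∀ j : ℤ, g (t + (-j : ℝ)) ≠ 0 → ∀ n : ℤ, n ≠ 0 →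
        g (t + (-j : ℝ) - n) ≠ 0 → A' ≤ |‖g (t + (-j : ℝ))‖ - ‖g (t + (-j : ℝ) - n)‖| :=
      ae_all_iff.2 fun j => (quasiMeasurePreserving_add_const (-j : ℝ)).ae h'
    filter_upwards [htwo, ae_restrict_of_ae h, ae_restrict_of_ae hall] with t ⟨p, q, hpq⟩ h1 h2
    rw [hpq.whG_zero_re] at h1
    refine ⟨p, q, hpq, ?_, h1.2⟩
    by_cases hp : g (t - p) = 0
    · refine (min_le_left _ _).trans (h1.1.trans_eq ?_)
      simp [hp]
    by_cases hq : g (t - q) = 0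
    · refine (min_le_left _ _).trans (h1.1.trans_eq ?_)
      simp [hq]
    have hne := hpq.1
    have h3 := h2 p (by rwa [← sub_eq_add_neg]) (q - p) (by omega)
    rw [show t + (-p : ℝ) - ((q - p : ℤ) : ℝ) = t - q by push_cast; ring, ← sub_eq_add_neg] at h3
    refine (min_le_right _ _).trans ?_
    rw [← sq_abs (‖g (t - p)‖ - _)]
    have := h3 hq
    gcongr

/-! ### Necessity of separation, by truncated characters -/

theorem exists_norm_add_exp_mul_eq (x y : ℂ) :
    ∃ θ : ℝ, ‖x + Complex.exp (θ * Complex.I) * y‖ = |‖x‖ - ‖y‖| := by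
  refine ⟨x.arg - y.arg + Real.pi, ?_⟩
  have h : x + Complex.exp (((x.arg - y.arg + Real.pi : ℝ) : ℂ) * Complex.I) * y =
      ((‖x‖ - ‖y‖ : ℝ) : ℂ) * Complex.exp (x.arg * Complex.I) := by
    have h1 : Complex.exp (((x.arg - y.arg + Real.pi : ℝ) : ℂ) * Complex.I) *
        Complex.exp (y.arg * Complex.I) = -Complex.exp (x.arg * Complex.I) := by
      rw [← Complex.exp_add, ← Complex.exp_add_pi_mul_I]
      congr 1
      push_cast
      ring
    push_cast at h1 ⊢
    linear_combination (‖y‖ : ℂ) * h1 - Complex.norm_mul_exp_arg_mul_I x -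
      Complex.exp ((x.arg - y.arg + Real.pi) * Complex.I) * Complex.norm_mul_exp_arg_mul_I y
  rw [h, norm_mul, Complex.norm_exp_ofReal_mul_I, mul_one, Complex.norm_real, Real.norm_eq_abs]

theorem le_of_forall_nat_mul_le_add {a b C : ℝ} (h : ∀ N : ℕ, a * N ≤ b * N + C) : a ≤ b := by
  by_contra! hlt
  obtain ⟨N, hN⟩ := exists_nat_gt (C / (a - b))
  rw [div_lt_iff₀ (by linarith)] at hN
  linarith [h N]

/-- A character is an eigenvector of every shift, so truncating it to length N leaves the symbol
value on at most N indices. The error lives where exactly one of the two shifted windows is active,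
and its size does not depend on N. -/
theorem IsSupportedAtPair.tsum_enorm_character_le {g : ℝ → ℂ} {t : ℝ} {p q : ℤ}
    (h : IsSupportedAtPair g t p q) (r : ℝ) (N : ℕ) :
    ∑' n : ℤ, ‖∑ j ∈ Finset.Ico (0 : ℤ) N,
        conj (Complex.exp ((r * j : ℝ) * Complex.I)) * g (t + j - n)‖ₑ ^ 2 ≤
      ENNReal.ofReal (‖g (t - p) + Complex.exp ((r * (q - p) : ℝ) * Complex.I) * g (t - q)‖ ^ 2 * N +
        4 * |(p - q : ℝ)| * (‖g (t - p)‖ ^ 2 + ‖g (t - q)‖ ^ 2)) := by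
  set x := g (t - p)
  set y := g (t - q)
  set d := ‖x + Complex.exp ((r * (q - p) : ℝ) * Complex.I) * y‖ ^ 2
  set C := ‖x‖ ^ 2 + ‖y‖ ^ 2 with hC
  set a : ℤ → ℂ := fun j => if j ∈ Finset.Ico (0 : ℤ) N then
    conj (Complex.exp ((r * j : ℝ) * Complex.I)) else 0 with ha
  have hsum : ∀ n : ℤ, ∑ j ∈ Finset.Ico (0 : ℤ) N,
      conj (Complex.exp ((r * j : ℝ) * Complex.I)) * g (t + j - n) =
        a (n - p) * x + a (n - q) * y := fun n => by
    rw [← (h.hasSum_mul a n).tsum_eq, tsum_eq_sum (s := Finset.Ico (0 : ℤ) N)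
      fun j hj => by simp only [ha, if_neg hj, zero_mul]]
    exact Finset.sum_congr rfl fun j hj => by simp only [ha, if_pos hj]
  have hna : ∀ r' : ℝ, ‖conj (Complex.exp ((r' : ℂ) * Complex.I))‖ = 1 := fun r' => by
    rw [RCLike.norm_conj, Complex.norm_exp_ofReal_mul_I]
  set U := Finset.Ico p (p + N)
  -- T contains the symmetric difference of [p, p+N) and [q, q+N), whichever of p, q is smaller.
  set T : Finset ℤ := (Finset.Ico p q ∪ Finset.Ico q p) ∪
    (Finset.Ico (p + N) (q + N) ∪ Finset.Ico (q + N) (p + N)) with hT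
  have hTcard : (T.card : ℝ) ≤ 4 * |(p - q : ℝ)| := by
    have h1 : T.card ≤ 4 * (p - q).natAbs := by
      refine (Finset.card_union_le _ _).trans ?_
      refine (add_le_add (Finset.card_union_le _ _) (Finset.card_union_le _ _)).trans ?_
      simp only [Int.card_Ico]
      omega
    have h2 : (T.card : ℝ) ≤ 4 * ((p - q).natAbs : ℝ) := by exact_mod_cast h1
    rwa [Nat.cast_natAbs, Int.cast_abs, Int.cast_sub] at h2
  have hpt : ∀ n : ℤ, ‖a (n - p) * x + a (n - q) * y‖ ^ 2 ≤
      (if n ∈ U then d else 0) + if n ∈ T then C else 0 := fun n => by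
    have hd0 : 0 ≤ d := by positivity
    have hx0 : 0 ≤ ‖x‖ ^ 2 := by positivity
    have hy0 : 0 ≤ ‖y‖ ^ 2 := by positivity
    have hU0 : 0 ≤ if n ∈ U then d else 0 := by split_ifs <;> simp [hd0]
    have hT0 : 0 ≤ if n ∈ T then C else 0 := by split_ifs <;> simp [hC]; positivity
    by_cases h1 : n - p ∈ Finset.Ico (0 : ℤ) N <;> by_cases h2 : n - q ∈ Finset.Ico (0 : ℤ) N
    · have hnU : n ∈ U := by
        simp only [U, Finset.mem_Ico] at h1 ⊢
        omega
      have he : a (n - p) * x + a (n - q) * y =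
          conj (Complex.exp ((r * (n - p : ℤ) : ℝ) * Complex.I)) *
            (x + Complex.exp ((r * (q - p) : ℝ) * Complex.I) * y) := by
        simp only [ha, if_pos h1, if_pos h2, ← Complex.exp_conj, mul_add, ← mul_assoc,
          ← Complex.exp_add]
        congr 3
        simp
        ring
      rw [he, norm_mul, hna, one_mul, if_pos hnU]
      linarith
    · have hnT : n ∈ T := by
        simp only [hT, Finset.mem_union, Finset.mem_Ico] at h1 h2 ⊢
        omega
      simp only [ha, if_pos h1, if_neg h2, zero_mul, add_zero, norm_mul, hna, one_mul, if_pos hnT]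
      linarith
    · have hnT : n ∈ T := by
        simp only [hT, Finset.mem_union, Finset.mem_Ico] at h1 h2 ⊢
        omega
      simp only [ha, if_neg h1, if_pos h2, zero_mul, zero_add, norm_mul, hna, one_mul, if_pos hnT]
      linarith
    · simp only [ha, if_neg h1, if_neg h2, zero_mul, zero_add, norm_zero]
      linarith
  simp_rw [hsum, enorm_sq_eq_ofReal]
  rw [tsum_eq_sum (s := U ∪ T) fun n hn => by
      rw [Finset.mem_union, not_or] at hn
      have := hpt n
      rw [if_neg hn.1, if_neg hn.2, add_zero] at this
      exact ENNReal.ofReal_eq_zero.2 this,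
    ← ENNReal.ofReal_sum_of_nonneg fun _ _ => by positivity]
  refine ENNReal.ofReal_le_ofReal ((Finset.sum_le_sum fun n _ => hpt n).trans ?_)
  rw [Finset.sum_add_distrib, Finset.sum_ite_mem, Finset.sum_ite_mem,
    Finset.inter_eq_right.2 Finset.subset_union_left,
    Finset.inter_eq_right.2 Finset.subset_union_right, Finset.sum_const, Finset.sum_const,
    nsmul_eq_mul, nsmul_eq_mul]
  have hUc : (U.card : ℝ) = N := by simp [U]
  rw [hUc]
  have : 0 ≤ C := by positivity
  have h5 : T.card * C ≤ 4 * |(p - q : ℝ)| * C := by gcongr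
  linarith

theorem IsWHFrame.hasSeparatedPairs {g : ℝ → ℂ} {hg : MemLp g 2 volume}
    (htwo : ∀ᵐ t ∂(volume.restrict (Ioc (0 : ℝ) 1)), ∃ p q, IsSupportedAtPair g t p q)
    (h : IsWHFrame g hg 1 1) : HasSeparatedPairs g := by
  obtain ⟨A, B, hA, hB, h⟩ := isFrame_iff_enorm.1 h
  -- The unit sequence at 0 yields ∑ₙ |g(t-n)|² ≤ B.
  have hup := ae_fibre_bounds_of_frame_bounds hg h {0} fun _ => 1
  -- Rational frequencies keep the family of test sequences countable, so one null set serves them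
  -- all.
  have hlow : ∀ᵐ t ∂(volume.restrict (Ioc (0 : ℝ) 1)), ∀ (r : ℚ) (N : ℕ), _ :=
    ae_all_iff.2 fun r : ℚ => ae_all_iff.2 fun N : ℕ =>
      ae_fibre_bounds_of_frame_bounds hg h (Finset.Ico (0 : ℤ) N)
        fun j => Complex.exp ((r * j : ℝ) * Complex.I)
  refine hasSeparatedPairs_of_ae_restrict (A := A) (B := B) hA ?_
  filter_upwards [htwo, hup, hlow] with t ⟨p, q, hpq⟩ h1 h2
  refine ⟨p, q, hpq, ?_, ?_⟩
  · have hrat : ∀ r : ℚ, A ≤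
        ‖g (t - p) + Complex.exp (((r : ℝ) * (q - p) : ℝ) * Complex.I) * g (t - q)‖ ^ 2 :=
      fun r => le_of_forall_nat_mul_le_add fun N => by
        have h3 := (h2 r N).1.trans (hpq.tsum_enorm_character_le r N)
        have hF : ∀ j : ℤ, ‖Complex.exp (((r : ℝ) * j : ℝ) * Complex.I)‖ₑ ^ 2 = 1 := fun j => by
          rw [enorm_sq_eq_ofReal, Complex.norm_exp_ofReal_mul_I]
          simp
        simp only [hF, Finset.sum_const, Int.card_Ico, sub_zero, Int.toNat_natCast, nsmul_eq_mul,
          mul_one] at h3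
        rw [← ENNReal.ofReal_natCast, ← ENNReal.ofReal_mul hA.le,
          ENNReal.ofReal_le_ofReal_iff (by positivity)] at h3
        exact h3
    have hreal : ∀ r : ℝ, A ≤
        ‖g (t - p) + Complex.exp ((r * (q - p) : ℝ) * Complex.I) * g (t - q)‖ ^ 2 := fun r =>
      Rat.denseRange_cast.induction_on r
        (isClosed_le continuous_const (by fun_prop)) hrat
    obtain ⟨θ, hθ⟩ := exists_norm_add_exp_mul_eq (g (t - p)) (g (t - q))
    have hne : (q - p : ℝ) ≠ 0 := by
      rw [sub_ne_zero]
      exact_mod_cast hpq.1.symm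
    -- As p ≠ q, this frequency puts the two terms in antiphase, where the symbol has modulus
    -- ||x|-|y||.
    have h3 := hreal (θ / (q - p))
    rwa [div_mul_cancel₀ _ hne, hθ, sq_abs] at h3
  · have h3 := (ENNReal.sum_le_tsum {p, q}).trans h1.2
    rw [Finset.sum_pair hpq.1] at h3
    simp only [Finset.sum_singleton, map_one, one_mul, Int.cast_zero, add_zero, enorm_one,
      one_pow, mul_one, enorm_sq_eq_ofReal] at h3
    rwa [← ENNReal.ofReal_add (by positivity) (by positivity),
      ENNReal.ofReal_le_ofReal_iff hB] at h3

theorem propositionP2 (g : ℝ → ℂ) (hg : MemLp g 2 volume)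
    (htwo : ∀ᵐ t ∂(volume.restrict (Set.Icc (0 : ℝ) 1)),
      {n : ℤ | g (t - n) ≠ 0}.encard ≤ 2) :
    List.TFAE [
      IsWHFrame g hg 1 1,
      CCCondition g 1 1,
      (∃ A B : ℝ, 0 < A ∧
        ∀ᵐ t : ℝ, A ≤ (whG g 1 1 0 t).re ∧ (whG g 1 1 0 t).re ≤ B) ∧
      (∃ A : ℝ, 0 < A ∧
        ∀ᵐ t : ℝ, g t ≠ 0 → ∀ n : ℤ, n ≠ 0 → g (t - n) ≠ 0 →
          A ≤ |‖g t‖ - ‖g (t - n)‖|)] := by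
  rw [← restrict_Ioc_eq_restrict_Icc] at htwo
  have hpair : ∀ᵐ t ∂(volume.restrict (Ioc (0 : ℝ) 1)), ∃ p q, IsSupportedAtPair g t p q :=
    htwo.mono fun t ht => exists_isSupportedAtPair ht
  have h12 : IsWHFrame g hg 1 1 ↔ CCCondition g 1 1 :=
    Iff.trans ⟨fun h => h.hasSeparatedPairs hpair, fun h => h.isWHFrame hg⟩
      (hasSeparatedPairs_iff_ccCondition hpair)
  have h23 := (hasSeparatedPairs_iff_ccCondition hpair).symm.trans
    (hasSeparatedPairs_iff_values_separated hpair)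
  tfae_have 1 ↔ 2 := h12
  tfae_have 2 ↔ 3 := h23
  tfae_finish
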